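/- **Definitions.** An inverse semigroup is a semigroup in which every element $a$ has a unique inverse, i.e. a unique element $a^{-1}$ with $aa^{-1}a=a$ and $a^{-1}aa^{-1}=a^{-1}$. It is ordered by the natural partial order: $a\le b$ iff $a=be$ for some idempotent $e$; joins are taken with respect to this order, and $\mathsf{E}(S)$ denotes the set of idempotents of $S$. Elements $a,b$ are compatible if $a^{-1}b$ and $ab^{-1}$ are idempotents. A Boolean inverse semigroup is an inverse semigroup with zero in which any two compatible elements have a join, in which multiplication distributes on both sides over such joins, and whose poset of idempotents is a generalized Boolean algebra, i.e. a distributive lattice with bottom and relative complements $e\setminus f$. A Boolean inverse monoid is a Boolean inverse semigroup with an identity $1$; in it, $e' = 1\setminus e$ for $e$ idempotent. A subalgebra of a Boolean inverse semigroup $T$ is an inverse subsemigroup of $T$ containing $0$ that is closed under joins, taken in $T$, of two compatible elements and under $(e,f)\mapsto e\setminus f$ for idempotents $e,f$. An ideal of $T$ is a non-empty subset $I$ with $TI\subseteq I$ and $IT\subseteq I$. **Proposition (Unitization).** Let $S$ be a Boolean inverse semigroup which is not a monoid, i.e. has no identity element. Then there is a Boolean inverse monoid $T$ that contains (an isomorphic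 copy of) $S$ as a subalgebra and as an ideal, such that each element of $T\setminus S$ is of the form $e'\vee s$ for some $e\in\mathsf{E}(S)$ and some $s\in eSe$, where the complement $e'$ and the join are taken in $T$. -/

import Mathlib

universe u v

/-- An inverse semigroup: every element `a` has exactly one inverse `a⁻¹`, that is, exactly one
element `b` with `a * b * a = a` and `b * a * b = b`. -/
class InverseSemigroup (S : Type u) extends Semigroup S, Inv S where
  mul_inv_mul (a : S) : a * a⁻¹ * a = a
  inv_mul_inv (a : S) : a⁻¹ * a * a⁻¹ = a⁻¹
  eq_inv_of (a b : S) : a * b * a = a → b * a * b = b → b = a⁻¹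

namespace InverseSemigroup

variable {S : Type u} [InverseSemigroup S]

/-- The product of two idempotents is idempotent. -/
theorem isIdempotentElem_mul {e f : S} (he : IsIdempotentElem e) (hf : IsIdempotentElem f) :
    IsIdempotentElem (e * f) := by
  have h1 := mul_inv_mul (e * f)
  have h2 := inv_mul_inv (e * f)
  have hee : ∀ y, e * (e * y) = e * y := fun y => by rw [← mul_assoc, he.eq]
  have hff : ∀ y, f * (f * y) = f * y := fun y => by rw [← mul_assoc, hf.eq]
  set x := (e * f)⁻¹ with hx
  simp only [mul_assoc] at h1 h2
  have h2' : ∀ y, x * (e * (f * (x * y))) = x * y := fun y => by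
    have := congrArg (· * y) h2
    simpa only [mul_assoc] using this
  have h3 : f * x * e = x := by
    refine eq_inv_of (e * f) (f * x * e) ?_ ?_
    · simp only [mul_assoc, hee, hff, h1]
    · simp only [mul_assoc, hee, hff, h2']
  have hxi : x * x = x := by
    calc x * x = (f * x * e) * (f * x * e) := by rw [h3]
      _ = f * x * e := by simp only [mul_assoc, h2']
      _ = x := h3
  have h4 : x = x⁻¹ := eq_inv_of x x (by rw [hxi, hxi]) (by rw [hxi, hxi])
  have h5 : e * f = x⁻¹ :=
    eq_inv_of x (e * f) (by simpa only [mul_assoc] using h2) (by simpa only [mul_assoc] using h1)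
  rw [h5, ← h4]
  exact hxi

/-- Idempotents of an inverse semigroup commute. -/
theorem idempotent_comm {e f : S} (he : IsIdempotentElem e) (hf : IsIdempotentElem f) :
    e * f = f * e := by
  have h1 := (isIdempotentElem_mul he hf).eq
  have h2 := (isIdempotentElem_mul hf he).eq
  have hee : ∀ y, e * (e * y) = e * y := fun y => by rw [← mul_assoc, he.eq]
  have hff : ∀ y, f * (f * y) = f * y := fun y => by rw [← mul_assoc, hf.eq]
  have a1 : e * f = (e * f)⁻¹ := eq_inv_of _ _ (by rw [h1, h1]) (by rw [h1, h1])
  have a2 : f * e = (e * f)⁻¹ := by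
    refine eq_inv_of _ _ ?_ ?_
    · simp only [mul_assoc, hee, hff] at h1 ⊢
      exact h1
    · simp only [mul_assoc, hee, hff] at h2 ⊢
      exact h2
  rw [a1, ← a2]

/-- The natural partial order: `a ≤ b` if and only if `a = b * e` for some idempotent `e`. -/
instance naturalOrder : PartialOrder S where
  le a b := ∃ e : S, IsIdempotentElem e ∧ a = b * e
  le_refl a := ⟨a⁻¹ * a, by
    rw [IsIdempotentElem, ← mul_assoc, inv_mul_inv], by rw [← mul_assoc, mul_inv_mul]⟩
  le_trans := by
    rintro a b c ⟨e, he, rfl⟩ ⟨f, hf, rfl⟩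
    exact ⟨f * e, isIdempotentElem_mul hf he, by rw [mul_assoc]⟩
  le_antisymm := by
    rintro a b ⟨e, he, h1⟩ ⟨f, hf, h2⟩
    have h3 : a = a * (e * f) := by
      rw [idempotent_comm he hf, ← mul_assoc, ← h2]
      exact h1
    have h4 : a * f = a := by
      rw [h3, mul_assoc, mul_assoc, hf.eq]
    rw [h2, h4]

/-- Compatible elements: `a⁻¹ * b` and `a * b⁻¹` are both idempotent. -/
def Compatible (a b : S) : Prop :=
  IsIdempotentElem (a⁻¹ * b) ∧ IsIdempotentElem (a * b⁻¹)

end InverseSemigroup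

/-- The set `E(S)` of idempotents of `S`. -/
def Idem (S : Type u) [Mul S] : Type u := {e : S // IsIdempotentElem e}

/-- A distributive inverse semigroup: an inverse semigroup with zero in which all binary compatible
joins (for the natural partial order) exist, and multiplication distributes over them. -/
class DistributiveInverseSemigroup (S : Type u) extends
    InverseSemigroup S, SemigroupWithZero S where
  exists_join (a b : S) : InverseSemigroup.Compatible a b → ∃ c : S, IsLUB {a, b} c
  mul_join (a b c d : S) : InverseSemigroup.Compatible a b → IsLUB {a, b} c →
    IsLUB {d * a, d * b} (d * c)
  join_mul (a b c d : S) : InverseSemigroup.Compatible a b → IsLUB {a, b} c →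
    IsLUB {a * d, b * d} (c * d)

/-- A Boolean inverse semigroup: a distributive inverse semigroup whose idempotents form a
generalized Boolean algebra under the natural partial order. (All the operations of a generalized
Boolean algebra are determined by its order, so `idemAlgebra` is no additional choice.) -/
class BooleanInverseSemigroup (S : Type u) extends DistributiveInverseSemigroup S where
  idemAlgebra : GeneralizedBooleanAlgebra (Idem S)
  idem_le_iff (e f : Idem S) : e ≤ f ↔ e.val ≤ f.val

instance Idem.instGeneralizedBooleanAlgebra (S : Type u) [BooleanInverseSemigroup S] :
    GeneralizedBooleanAlgebra (Idem S) :=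
  BooleanInverseSemigroup.idemAlgebra

/-- A Boolean inverse monoid: a Boolean inverse semigroup with an identity. -/
class BooleanInverseMonoid (T : Type u) extends BooleanInverseSemigroup T, Monoid T

/-- The complement `e' = 1 \ e` of an idempotent `e` of a Boolean inverse monoid. -/
def Idem.compl {T : Type u} [BooleanInverseMonoid T] (e : Idem T) : Idem T :=
  (⟨1, IsIdempotentElem.one⟩ : Idem T) \ e

/-- The image of an idempotent under a semigroup homomorphism. -/
def Idem.map {S : Type u} {T : Type v} [Mul S] [Mul T] (φ : S →ₙ* T) (e : Idem S) : Idem T :=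
  ⟨φ e.val, e.property.map φ⟩

/-- A subalgebra of a Boolean inverse semigroup: an inverse subsemigroup (containing zero) that is
closed under binary compatible joins taken in `T` and under relative complements of idempotents. -/
structure IsBISSubalgebra {T : Type u} [BooleanInverseSemigroup T] (A : Set T) : Prop where
  zero_mem : (0 : T) ∈ A
  mul_mem : ∀ a ∈ A, ∀ b ∈ A, a * b ∈ A
  inv_mem : ∀ a ∈ A, a⁻¹ ∈ A
  join_mem : ∀ a ∈ A, ∀ b ∈ A, InverseSemigroup.Compatible a b →
    ∀ c : T, IsLUB {a, b} c → c ∈ A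
  sdiff_mem : ∀ e f : Idem T, e.val ∈ A → f.val ∈ A → (e \ f).val ∈ A

/-- A (two-sided) semigroup ideal. -/
structure IsSemigroupIdeal {T : Type u} [Mul T] (A : Set T) : Prop where
  nonempty : A.Nonempty
  mul_mem_left : ∀ t : T, ∀ a ∈ A, t * a ∈ A
  mul_mem_right : ∀ t : T, ∀ a ∈ A, a * t ∈ A

/-! The semigroup `S` is represented faithfully by partial bijections of a set, and the unitization
is then assembled from relations on that set. The points are germs of elements of `S` at prime
filters of idempotents, and `s` sends the germ of `x` at `P` to the germ of `s * x` at `P` whenever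
the domain of `s * x` lies in `P`. Products, inverses, compatible joins and relative complements of
idempotents become composition, converse, union and set difference (`germAct_mul`, `germAct_inv`,
`germAct_join`, `germAct_sdiff`). Prime ideal separation makes the representation order-reflecting,
hence injective (`le_of_germAct_le`).

The unitization consists of the relations of `s` together with, optionally, the identity off the
domain of an idempotent `g`, where `s` lies in `gSg`. Since `s` lives entirely inside `g`, the two
pieces do not interact. Enlarging `g` (`exists_unitRel_eq`) brings two elements over a common
idempotent, where each operation is carried out separately on the part in `gSg` and on the flag for
the identity part. The axioms then reduce to facts about relations, and the required form of the
elements outside `S` is built into the definition. -/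

namespace InverseSemigroup

variable {S : Type u} [InverseSemigroup S]

/-! ### Calculus of inverses, idempotents and the natural order -/

theorem inv_inv' (a : S) : a⁻¹⁻¹ = a :=
  (eq_inv_of a⁻¹ a (inv_mul_inv a) (mul_inv_mul a)).symm

theorem isIdempotentElem_inv_mul (a : S) : IsIdempotentElem (a⁻¹ * a) := by
  rw [IsIdempotentElem, ← mul_assoc, inv_mul_inv]

theorem isIdempotentElem_mul_inv (a : S) : IsIdempotentElem (a * a⁻¹) := by
  rw [IsIdempotentElem, ← mul_assoc, mul_inv_mul]

theorem inv_eq_of_isIdempotentElem {e : S} (he : IsIdempotentElem e) : e⁻¹ = e :=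
  (eq_inv_of e e (by rw [he.eq, he.eq]) (by rw [he.eq, he.eq])).symm

theorem mul_inv_rev' (a b : S) : (a * b)⁻¹ = b⁻¹ * a⁻¹ := by
  have h := idempotent_comm (isIdempotentElem_mul_inv b) (isIdempotentElem_inv_mul a)
  refine (eq_inv_of _ _ ?_ ?_).symm
  · calc a * b * (b⁻¹ * a⁻¹) * (a * b) = a * (b * b⁻¹ * (a⁻¹ * a)) * b := by simp only [mul_assoc]
      _ = (a * a⁻¹ * a) * (b * b⁻¹ * b) := by rw [h]; simp only [mul_assoc]
      _ = a * b := by rw [mul_inv_mul, mul_inv_mul]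
  · calc b⁻¹ * a⁻¹ * (a * b) * (b⁻¹ * a⁻¹) = b⁻¹ * (a⁻¹ * a * (b * b⁻¹)) * a⁻¹ := by
          simp only [mul_assoc]
      _ = (b⁻¹ * b * b⁻¹) * (a⁻¹ * a * a⁻¹) := by rw [← h]; simp only [mul_assoc]
      _ = b⁻¹ * a⁻¹ := by rw [inv_mul_inv, inv_mul_inv]

/-- The domain idempotent `a⁻¹ * a`. -/
def dom (a : S) : Idem S := ⟨a⁻¹ * a, isIdempotentElem_inv_mul a⟩

theorem mul_dom (a : S) : a * (dom a).val = a := by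
  rw [dom, ← mul_assoc, mul_inv_mul]

theorem mul_idem_le (a : S) (e : Idem S) : a * e.val ≤ a := ⟨e.val, e.property, rfl⟩

theorem isIdempotentElem_of_le {a e : S} (he : IsIdempotentElem e) (h : a ≤ e) :
    IsIdempotentElem a := by
  obtain ⟨f, hf, rfl⟩ := h
  exact isIdempotentElem_mul he hf

theorem idem_le_iff_mul {e f : S} (he : IsIdempotentElem e) (hf : IsIdempotentElem f) :
    e ≤ f ↔ f * e = e := by
  refine ⟨?_, fun h => ⟨e, he, h.symm⟩⟩
  rintro ⟨g, -, rfl⟩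
  rw [← mul_assoc, hf.eq]

theorem isIdempotentElem_inv_conj (a : S) {e : S} (he : IsIdempotentElem e) :
    IsIdempotentElem (a⁻¹ * e * a) := by
  have h : a⁻¹ * e * a = (e * a)⁻¹ * (e * a) := by
    rw [mul_inv_rev', inv_eq_of_isIdempotentElem he]
    simp only [mul_assoc]
    rw [← mul_assoc e e, he.eq]
  rw [h]
  exact isIdempotentElem_inv_mul _

theorem isIdempotentElem_conj (a : S) {e : S} (he : IsIdempotentElem e) :
    IsIdempotentElem (a * e * a⁻¹) := by
  have := isIdempotentElem_inv_conj a⁻¹ he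
  rwa [inv_inv'] at this

/-- An idempotent may be moved across an element. -/
theorem idem_mul_eq (a : S) {e : S} (he : IsIdempotentElem e) :
    e * a = a * (a⁻¹ * e * a) := by
  calc e * a = e * (a * a⁻¹) * a := by rw [mul_assoc, mul_inv_mul]
    _ = (a * a⁻¹) * e * a := by rw [idempotent_comm he (isIdempotentElem_mul_inv a)]
    _ = _ := by simp only [mul_assoc]

theorem idem_mul_le (a : S) {e : S} (he : IsIdempotentElem e) : e * a ≤ a :=
  ⟨_, isIdempotentElem_inv_conj a he, idem_mul_eq a he⟩

theorem mul_le_mul_right' {a b : S} (h : a ≤ b) (c : S) : a * c ≤ b * c := by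
  obtain ⟨e, he, rfl⟩ := h
  rw [mul_assoc, idem_mul_eq c he, ← mul_assoc]
  exact ⟨_, isIdempotentElem_inv_conj c he, rfl⟩

theorem eq_mul_dom_of_le {a b : S} (h : a ≤ b) : a = b * (a⁻¹ * a) := by
  obtain ⟨e, he, rfl⟩ := h
  rw [mul_inv_rev', inv_eq_of_isIdempotentElem he]
  have h1 := idempotent_comm he (isIdempotentElem_inv_mul b)
  calc b * e = b * b⁻¹ * b * (e * e) := by rw [mul_inv_mul, he.eq]
    _ = b * (b⁻¹ * b * e) * e := by simp only [mul_assoc]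
    _ = b * (e * b⁻¹ * (b * e)) := by rw [← h1]; simp only [mul_assoc]

theorem inv_mul_eq_of_le {a b : S} (h : a ≤ b) : b⁻¹ * a = a⁻¹ * a := by
  have h1 := eq_mul_dom_of_le h
  have h2 : b⁻¹ * a = b⁻¹ * b * (a⁻¹ * a) := by rw [mul_assoc, ← h1]
  have h3 : a * (b⁻¹ * b) = a := by
    obtain ⟨e, he, rfl⟩ := h
    rw [mul_assoc, idempotent_comm he (isIdempotentElem_inv_mul b), ← mul_assoc, ← mul_assoc,
      mul_inv_mul]
  rw [h2, idempotent_comm (isIdempotentElem_inv_mul b) (isIdempotentElem_inv_mul a), mul_assoc, h3]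

/-- Writing `a = c * e` and `b = c * f`, one gets `e * (c⁻¹ * c) * f`, a product of idempotents, and
the conjugate of `e * f` by `c`. -/
theorem compatible_of_le {a b c : S} (ha : a ≤ c) (hb : b ≤ c) : Compatible a b := by
  obtain ⟨e, he, rfl⟩ := ha
  obtain ⟨f, hf, rfl⟩ := hb
  constructor
  · rw [mul_inv_rev', inv_eq_of_isIdempotentElem he]
    have : e * c⁻¹ * (c * f) = e * (c⁻¹ * c) * f := by simp only [mul_assoc]
    rw [this]
    exact isIdempotentElem_mul (isIdempotentElem_mul he (isIdempotentElem_inv_mul c)) hf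
  · rw [mul_inv_rev', inv_eq_of_isIdempotentElem hf]
    have : c * e * (f * c⁻¹) = c * (e * f) * c⁻¹ := by simp only [mul_assoc]
    rw [this]
    exact isIdempotentElem_conj c (isIdempotentElem_mul he hf)

theorem dom_mul_val (s x : S) : (dom (s * x)).val = x⁻¹ * (s⁻¹ * s) * x := by
  simp only [dom, mul_inv_rev', mul_assoc]

/-- `s⁻¹ * s * x` agrees with `x` on the domain of `s * x`. -/
theorem inv_mul_mul_eq (s x : S) : s⁻¹ * (s * x) = x * (dom (s * x)).val := by
  rw [dom_mul_val, ← idem_mul_eq x (isIdempotentElem_inv_mul s), mul_assoc]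

end InverseSemigroup

namespace BooleanInverseSemigroup

open InverseSemigroup

variable {S : Type u} [BooleanInverseSemigroup S]

/-! ### Lattice operations on idempotents, computed in `S` -/

theorem val_bot : (⊥ : Idem S).val = 0 := by
  have h0 : IsIdempotentElem (0 : S) := mul_zero 0
  have h := (idem_le_iff (⊥ : Idem S) ⟨0, h0⟩).1 bot_le
  obtain ⟨e, -, h⟩ := h
  rw [h, zero_mul]

theorem le_iff_mul {e f : Idem S} : e ≤ f ↔ f.val * e.val = e.val := by
  rw [idem_le_iff, idem_le_iff_mul e.property f.property]

theorem val_inf (e f : Idem S) : (e ⊓ f).val = e.val * f.val := by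
  have hi := isIdempotentElem_mul e.property f.property
  let m : Idem S := ⟨e.val * f.val, hi⟩
  have h1 : m ≤ e ⊓ f :=
    le_inf ((idem_le_iff m e).2 (mul_idem_le _ _)) ((idem_le_iff m f).2 (idem_mul_le _ e.property))
  have h2 := le_iff_mul.1 (inf_le_left : e ⊓ f ≤ e)
  have h3 := le_iff_mul.1 (inf_le_right : e ⊓ f ≤ f)
  have h5 : e ⊓ f ≤ m := le_iff_mul.2 (by
    change e.val * f.val * (e ⊓ f).val = _
    rw [mul_assoc, h3, h2])
  have h6 : e ⊓ f = m := le_antisymm (α := Idem S) h5 h1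
  rw [h6]

/-- The lattice supremum is a priori least only among idempotents. The join in `S` lies below it, so
it is itself idempotent and the two agree. -/
theorem isLUB_val_sup (e f : Idem S) : IsLUB {e.val, f.val} (e ⊔ f).val := by
  have he := (idem_le_iff _ _).1 (le_sup_left : e ≤ e ⊔ f)
  have hf := (idem_le_iff _ _).1 (le_sup_right : f ≤ e ⊔ f)
  obtain ⟨c, hc⟩ := DistributiveInverseSemigroup.exists_join e.val f.val (compatible_of_le he hf)
  have hcs : c ≤ (e ⊔ f).val := hc.2 (by rintro x (rfl | rfl) <;> assumption)
  have hci := isIdempotentElem_of_le (e ⊔ f).property hcs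
  have : e ⊔ f ≤ ⟨c, hci⟩ := sup_le ((idem_le_iff _ _).2 (hc.1 (by simp)))
    ((idem_le_iff _ _).2 (hc.1 (by simp)))
  rwa [le_antisymm ((idem_le_iff _ _).1 this) hcs]

/-- Makes the distributivity axioms applicable to any join that exists. -/
theorem compatible_of_isLUB {a b c : S} (h : IsLUB {a, b} c) : Compatible a b :=
  compatible_of_le (h.1 (by simp)) (h.1 (by simp))

/-- The domain of a join is covered by the domains of its two parts. -/
theorem dom_le_of_isLUB {a b c : S} (h : IsLUB {a, b} c) : dom c ≤ dom a ⊔ dom b := by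
  -- Multiplying the join by `c⁻¹` turns it into the join of the domain idempotents.
  have h1 := DistributiveInverseSemigroup.mul_join a b c c⁻¹ (compatible_of_isLUB h) h
  rw [inv_mul_eq_of_le (h.1 (by simp) : a ≤ c), inv_mul_eq_of_le (h.1 (by simp) : b ≤ c)] at h1
  rw [idem_le_iff]
  apply h1.2
  rintro x (rfl | rfl)
  · exact (idem_le_iff _ _).1 (le_sup_left : dom a ≤ dom a ⊔ dom b)
  · exact (idem_le_iff _ _).1 (le_sup_right : dom b ≤ dom a ⊔ dom b)

/-! ### Prime filters and germs -/

/-- The prime filters of the idempotents, given by the complementary prime ideals. -/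
def PrimeFilter (S : Type u) [BooleanInverseSemigroup S] : Type u :=
  {J : Order.Ideal (Idem S) // J.IsPrime}

/-- Membership of an idempotent in a prime filter. -/
def PrimeFilter.Mem (P : PrimeFilter S) (e : Idem S) : Prop := e ∉ P.val

namespace PrimeFilter

variable (P : PrimeFilter S)

theorem Mem.mono {P : PrimeFilter S} {e f : Idem S} (h : P.Mem e) (hef : e ≤ f) : P.Mem f :=
  fun hf => h (P.val.lower hef hf)

theorem Mem.inf {P : PrimeFilter S} {e f : Idem S} (he : P.Mem e) (hf : P.Mem f) :
    P.Mem (e ⊓ f) :=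
  fun h => (P.property.mem_or_mem h).elim he hf

theorem Mem.or {P : PrimeFilter S} {e f : Idem S} (h : P.Mem (e ⊔ f)) : P.Mem e ∨ P.Mem f := by
  by_contra hc
  simp only [Mem, not_or, not_not] at hc
  exact h (Order.Ideal.sup_mem hc.1 hc.2)

theorem not_mem_bot : ¬ P.Mem ⊥ := fun h => h P.val.bot_mem

theorem nonempty : ∃ e, P.Mem e := by
  by_contra hc
  simp only [Mem, not_exists, not_not] at hc
  exact P.property.ne_univ (Set.eq_univ_of_forall hc)

end PrimeFilter

/-- Two pairs are equivalent if they have the same germ. -/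
def germSetoid (S : Type u) [BooleanInverseSemigroup S] : Setoid (S × PrimeFilter S) where
  r p q := p.2 = q.2 ∧ ∃ e : Idem S, p.2.Mem e ∧ p.1 * e.val = q.1 * e.val
  iseqv :=
    { refl := fun p => ⟨rfl, (PrimeFilter.nonempty p.2).imp fun e he => ⟨he, rfl⟩⟩
      symm := by
        rintro ⟨x, P⟩ ⟨y, Q⟩ ⟨h, e, he, hxy⟩
        obtain rfl : P = Q := h
        exact ⟨rfl, e, he, hxy.symm⟩
      trans := by
        rintro ⟨x, P⟩ ⟨y, Q⟩ ⟨z, R⟩ ⟨h, e, he, hxy⟩ ⟨h', f, hf, hyz⟩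
        obtain rfl : P = Q := h
        obtain rfl : P = R := h'
        refine ⟨rfl, e ⊓ f, he.inf hf, ?_⟩
        dsimp only at *
        rw [val_inf, ← mul_assoc, hxy, mul_assoc, idempotent_comm e.property f.property,
          ← mul_assoc, hyz, mul_assoc] }

/-- Germs of elements of `S` at prime filters of idempotents. -/
def Germ (S : Type u) [BooleanInverseSemigroup S] : Type u := Quotient (germSetoid S)

/-- The germ of `x` at `P`. -/
def Germ.mk (x : S) (P : PrimeFilter S) : Germ S := Quotient.mk (germSetoid S) (x, P)

theorem Germ.ind {p : Germ S → Prop} (h : ∀ x P, p (Germ.mk x P)) (g : Germ S) : p g :=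
  Quotient.ind (fun q => h q.1 q.2) g

theorem Germ.mk_eq_iff {x y : S} {P Q : PrimeFilter S} :
    Germ.mk x P = Germ.mk y Q ↔ P = Q ∧ ∃ e : Idem S, P.Mem e ∧ x * e.val = y * e.val :=
  Quotient.eq (r := germSetoid S)

theorem Germ.mk_eq {x y : S} {P : PrimeFilter S} {e : Idem S} (he : P.Mem e)
    (h : x * e.val = y * e.val) : Germ.mk x P = Germ.mk y P :=
  mk_eq_iff.2 ⟨rfl, e, he, h⟩

theorem Germ.mul_left (s : S) {x y : S} {P : PrimeFilter S} (h : Germ.mk x P = Germ.mk y P) :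
    Germ.mk (s * x) P = Germ.mk (s * y) P := by
  obtain ⟨-, e, he, h⟩ := mk_eq_iff.1 h
  exact mk_eq he (by rw [mul_assoc, h, mul_assoc])

theorem dom_mul_le (s x : S) : dom (s * x) ≤ dom x := by
  rw [le_iff_mul, dom_mul_val, dom]
  simp only [← mul_assoc, inv_mul_inv]

theorem dom_mul_idem (x : S) (e : Idem S) : dom (x * e.val) = dom x ⊓ e := by
  apply Subtype.ext
  have h := idempotent_comm e.property (isIdempotentElem_inv_mul x)
  change (x * e.val)⁻¹ * (x * e.val) = _
  rw [val_inf, mul_inv_rev', inv_eq_of_isIdempotentElem e.property]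
  change _ = x⁻¹ * x * e.val
  calc e.val * x⁻¹ * (x * e.val) = e.val * (x⁻¹ * x) * e.val := by simp only [mul_assoc]
    _ = x⁻¹ * x * e.val := by rw [h, mul_assoc, e.property.eq]

/-- A germ of `x` at `P` is allowed even when `dom x` is not in `P`; this shows that the distinction
depends on the germ alone. -/
theorem mem_dom_of_mk_eq {x y : S} {P : PrimeFilter S} (h : Germ.mk x P = Germ.mk y P)
    (hx : P.Mem (dom x)) : P.Mem (dom y) := by
  obtain ⟨-, e, he, h⟩ := Germ.mk_eq_iff.1 h
  have h1 := hx.inf he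
  rw [← dom_mul_idem, h, dom_mul_idem] at h1
  exact h1.mono inf_le_left

/-! ### Representation of `S` by partial bijections of germs -/

/-- The action of `s` on germs by left multiplication, as a relation. -/
def germAct (s : S) : Germ S → Germ S → Prop := fun g h =>
  ∃ (x : S) (P : PrimeFilter S), P.Mem (dom (s * x)) ∧ g = Germ.mk x P ∧ h = Germ.mk (s * x) P

theorem germAct_mk_iff {s x : S} {P : PrimeFilter S} {h : Germ S} :
    germAct s (Germ.mk x P) h ↔ P.Mem (dom (s * x)) ∧ h = Germ.mk (s * x) P := by
  constructor
  · rintro ⟨y, Q, hm, h1, rfl⟩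
    obtain rfl := (Germ.mk_eq_iff.1 h1).1
    have h2 := Germ.mul_left s h1
    exact ⟨mem_dom_of_mk_eq h2.symm hm, h2.symm⟩
  · rintro ⟨hm, rfl⟩
    exact ⟨x, P, hm, rfl, rfl⟩

theorem germAct_mul {s t : S} {g h : Germ S} :
    germAct (s * t) g h ↔ ∃ k, germAct t g k ∧ germAct s k h := by
  induction g using Germ.ind with | h x P =>
  simp only [germAct_mk_iff]
  constructor
  · rintro ⟨hm, rfl⟩
    rw [mul_assoc] at *
    exact ⟨_, ⟨hm.mono (dom_mul_le _ _), rfl⟩, germAct_mk_iff.2 ⟨hm, rfl⟩⟩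
  · rintro ⟨k, ⟨-, rfl⟩, h⟩
    rw [germAct_mk_iff] at h
    rwa [mul_assoc]

theorem germAct_inv_of {s : S} {g h : Germ S} (hs : germAct s g h) : germAct s⁻¹ h g := by
  induction g using Germ.ind with | h x P =>
  obtain ⟨hm, rfl⟩ := germAct_mk_iff.1 hs
  rw [germAct_mk_iff, inv_mul_mul_eq, dom_mul_idem]
  refine ⟨(hm.mono (dom_mul_le _ _)).inf hm, Germ.mk_eq hm ?_⟩
  rw [mul_assoc, (dom (s * x)).property.eq]

theorem germAct_inv {s : S} {g h : Germ S} : germAct s⁻¹ h g ↔ germAct s g h :=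
  ⟨fun hs => by have := germAct_inv_of hs; rwa [inv_inv'] at this, germAct_inv_of⟩

theorem germAct_right_unique {s : S} {g h k : Germ S} (h1 : germAct s g h) (h2 : germAct s g k) :
    h = k := by
  induction g using Germ.ind with | h x P =>
  rw [germAct_mk_iff] at h1 h2
  rw [h1.2, h2.2]

theorem germAct_left_unique {s : S} {g h k : Germ S} (h1 : germAct s h g) (h2 : germAct s k g) :
    h = k :=
  germAct_right_unique (germAct_inv.2 h1) (germAct_inv.2 h2)

theorem not_germAct_zero (g h : Germ S) : ¬ germAct 0 g h := by
  induction g using Germ.ind with | h x P =>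
  rw [germAct_mk_iff]
  rintro ⟨hm, -⟩
  apply P.not_mem_bot
  convert hm
  apply Subtype.ext
  rw [val_bot, zero_mul]
  exact (mul_zero _).symm

theorem germAct_mono {s t : S} (hst : s ≤ t) {g h : Germ S} (hs : germAct s g h) :
    germAct t g h := by
  induction g using Germ.ind with | h x P =>
  obtain ⟨hm, rfl⟩ := germAct_mk_iff.1 hs
  have h1 := eq_mul_dom_of_le (mul_le_mul_right' hst x)
  have h2 : Germ.mk (s * x) P = Germ.mk (t * x) P := Germ.mk_eq hm (by rw [mul_dom]; exact h1)
  exact germAct_mk_iff.2 ⟨mem_dom_of_mk_eq h2 hm, h2⟩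

/-- The domain of `c * x` is covered by those of `a * x` and `b * x`, and a prime filter containing
a join contains one of its parts. -/
theorem germAct_join {a b c : S} (hc : IsLUB {a, b} c) {g h : Germ S} :
    germAct c g h ↔ germAct a g h ∨ germAct b g h := by
  have hac : a ≤ c := hc.1 (by simp)
  have hbc : b ≤ c := hc.1 (by simp)
  refine ⟨fun h1 => ?_, fun h1 => h1.elim (germAct_mono hac) (germAct_mono hbc)⟩
  induction g using Germ.ind with | h x P =>
  obtain ⟨hm, rfl⟩ := germAct_mk_iff.1 h1
  have hx := DistributiveInverseSemigroup.join_mul a b c x (compatible_of_isLUB hc) hc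
  refine (hm.mono (dom_le_of_isLUB hx)).or.imp (fun hm => ?_) (fun hm => ?_)
  · have h3 : germAct a (Germ.mk x P) (Germ.mk (a * x) P) := germAct_mk_iff.2 ⟨hm, rfl⟩
    rwa [germAct_right_unique h1 (germAct_mono hac h3)]
  · have h3 : germAct b (Germ.mk x P) (Germ.mk (b * x) P) := germAct_mk_iff.2 ⟨hm, rfl⟩
    rwa [germAct_right_unique h1 (germAct_mono hbc h3)]

/-- An idempotent partial bijection is a partial identity. -/
theorem germAct_idem_eq {e : S} (he : IsIdempotentElem e) {g h : Germ S} (hg : germAct e g h) :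
    g = h := by
  have h1 := hg
  rw [← he.eq, germAct_mul] at h1
  obtain ⟨k, h1, h2⟩ := h1
  exact germAct_left_unique hg (germAct_right_unique hg h1 ▸ h2)

theorem germAct_sdiff (e f : Idem S) {g h : Germ S} :
    germAct (e \ f).val g h ↔ germAct e.val g h ∧ ¬ germAct f.val g h := by
  -- `e` is the join of `e ⊓ f` and `e \ f`, and `h0` says that the latter has empty composite with
  -- `f`.
  have h1 := isLUB_val_sup (e ⊓ f) (e \ f)
  rw [sup_inf_sdiff] at h1
  have h0 : ∀ k, ¬ (germAct f.val g k ∧ germAct (e \ f).val k h) := by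
    intro k hk
    have h2 := germAct_mul.2 ⟨k, hk⟩
    rw [← val_inf, inf_comm, inf_sdiff_self_right, val_bot] at h2
    exact not_germAct_zero _ _ h2
  rw [germAct_join h1]
  constructor
  · intro h3
    refine ⟨Or.inr h3, fun h4 => ?_⟩
    obtain rfl := germAct_idem_eq f.property h4
    exact h0 _ ⟨h4, h3⟩
  · rintro ⟨h3 | h3, h4⟩
    · rw [val_inf, germAct_mul] at h3
      obtain ⟨k, h5, h6⟩ := h3
      obtain rfl := germAct_idem_eq e.property h6
      exact absurd h5 h4
    · exact h3

/-- The idempotents on which `a` and `b` agree form an ideal, closed under joins by distributivity.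
If it misses `dom a`, some prime filter contains `dom a` and avoids the ideal; on the germ of `dom
a` there, `a` and `b` have the same value, so they agree on a member of the filter, a contradiction.
-/
theorem le_of_germAct_le {a b : S} (h : ∀ g k, germAct a g k → germAct b g k) : a ≤ b := by
  let I : Order.Ideal (Idem S) :=
    { carrier := {e | a * e.val = b * e.val}
      lower' := by
        intro e f hfe he
        have he : a * e.val = b * e.val := he
        have := le_iff_mul.1 hfe
        change a * f.val = b * f.val
        rw [← this, ← mul_assoc, he, mul_assoc]
      nonempty' := ⟨⊥, by simp [val_bot]⟩
      directed' := by
        intro e he f hf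
        refine ⟨e ⊔ f, ?_, le_sup_left, le_sup_right⟩
        have he : a * e.val = b * e.val := he
        have hf : a * f.val = b * f.val := hf
        have hl := isLUB_val_sup e f
        have h1 := DistributiveInverseSemigroup.mul_join _ _ _ a (compatible_of_isLUB hl) hl
        have h2 := DistributiveInverseSemigroup.mul_join _ _ _ b (compatible_of_isLUB hl) hl
        rw [he, hf] at h1
        exact h1.unique h2 }
  by_cases hI : dom a ∈ I
  · have hI : a * (dom a).val = b * (dom a).val := hI
    rw [mul_dom] at hI
    rw [hI]
    exact mul_idem_le _ _
  · exfalso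
    obtain ⟨J, hJ, hIJ, hd⟩ := DistribLattice.prime_ideal_of_disjoint_filter_ideal
      (F := Order.PFilter.principal (dom a)) (I := I) (Set.disjoint_left.2 fun e he heI =>
        hI (I.lower he heI))
    let P : PrimeFilter S := ⟨J, hJ⟩
    have hm : P.Mem (dom a) := Set.disjoint_left.1 hd (le_refl (dom a))
    have h1 := h (Germ.mk (dom a).val P) (Germ.mk (a * (dom a).val) P)
      (germAct_mk_iff.2 ⟨by rwa [mul_dom], rfl⟩)
    obtain ⟨-, h1⟩ := germAct_mk_iff.1 h1
    obtain ⟨-, e, he, h1⟩ := Germ.mk_eq_iff.1 h1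
    refine hm.inf he (hIJ (?_ : a * (dom a ⊓ e).val = b * (dom a ⊓ e).val))
    rw [val_inf, ← mul_assoc, h1, mul_assoc]

theorem germAct_injective : Function.Injective (germAct : S → Germ S → Germ S → Prop) :=
  fun a b h => le_antisymm (le_of_germAct_le fun _ _ => by rw [h]; exact id)
    (le_of_germAct_le fun _ _ => by rw [h]; exact id)

/-! ### Local monoids and transfer of properties from relations back to `S` -/

/-- `s` lives in the local monoid `g S g`. -/
def IsLocal (g : Idem S) (s : S) : Prop := g.val * s = s ∧ s * g.val = s

theorem IsLocal.mul {g : Idem S} {s t : S} (hs : IsLocal g s) (ht : IsLocal g t) :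
    IsLocal g (s * t) :=
  ⟨by rw [← mul_assoc, hs.1], by rw [mul_assoc, ht.2]⟩

theorem IsLocal.inv {g : Idem S} {s : S} (hs : IsLocal g s) : IsLocal g s⁻¹ := by
  have hg := inv_eq_of_isIdempotentElem g.property
  constructor
  · conv_rhs => rw [← hs.2, mul_inv_rev', hg]
  · conv_rhs => rw [← hs.1, mul_inv_rev', hg]

theorem IsLocal.join {g : Idem S} {a b c : S} (ha : IsLocal g a) (hb : IsLocal g b)
    (hc : IsLUB {a, b} c) : IsLocal g c := by
  have h1 := DistributiveInverseSemigroup.mul_join _ _ _ g.val (compatible_of_isLUB hc) hc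
  have h2 := DistributiveInverseSemigroup.join_mul _ _ _ g.val (compatible_of_isLUB hc) hc
  rw [ha.1, hb.1] at h1
  rw [ha.2, hb.2] at h2
  exact ⟨h1.unique hc, h2.unique hc⟩

theorem isLocal_of_le {e g : Idem S} (h : e ≤ g) : IsLocal g e.val :=
  ⟨le_iff_mul.1 h, by rw [idempotent_comm e.property g.property]; exact le_iff_mul.1 h⟩

theorem IsLocal.mono {g h : Idem S} {s : S} (hs : IsLocal g s) (hgh : g ≤ h) : IsLocal h s :=
  ⟨by rw [← hs.1, ← mul_assoc, (isLocal_of_le hgh).1],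
    by rw [← hs.2, mul_assoc, (isLocal_of_le hgh).2]⟩

theorem exists_isLocal (s : S) : ∃ g : Idem S, IsLocal g s := by
  have h1 : (dom s⁻¹).val * s = s := by
    change s⁻¹⁻¹ * s⁻¹ * s = s
    rw [inv_inv', mul_inv_mul]
  have h2 := (isLocal_of_le (le_sup_right : dom s⁻¹ ≤ dom s ⊔ dom s⁻¹)).1
  have h3 := (isLocal_of_le (le_sup_left : dom s ≤ dom s ⊔ dom s⁻¹)).2
  -- The join of the domain and range idempotents.
  refine ⟨dom s ⊔ dom s⁻¹, ?_, ?_⟩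
  · calc (dom s ⊔ dom s⁻¹).val * s = (dom s ⊔ dom s⁻¹).val * ((dom s⁻¹).val * s) := by rw [h1]
      _ = s := by rw [← mul_assoc, h2, h1]
  · calc s * (dom s ⊔ dom s⁻¹).val = s * (dom s).val * (dom s ⊔ dom s⁻¹).val := by rw [mul_dom]
      _ = s := by rw [mul_assoc, h3, mul_dom]

/-- Domain and image of `s` consist of fixed points of `g`; this keeps `s` apart from the identity
off `g`. -/
theorem germAct_of_isLocal {g : Idem S} {s : S} (hs : IsLocal g s) {x y : Germ S}
    (h : germAct s x y) : germAct g.val x x ∧ germAct g.val y y := by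
  constructor
  · rw [← hs.2, germAct_mul] at h
    obtain ⟨k, h, -⟩ := h
    obtain rfl := germAct_idem_eq g.property h
    exact h
  · rw [← hs.1, germAct_mul] at h
    obtain ⟨k, -, h⟩ := h
    obtain rfl := germAct_idem_eq g.property h
    exact h

theorem isIdempotentElem_of_germAct_eq {s : S} (h : ∀ x y, germAct s x y → x = y) :
    IsIdempotentElem s := by
  refine germAct_injective (funext₂ fun x y => propext ?_)
  rw [germAct_mul]
  refine ⟨?_, fun h1 => ?_⟩
  · rintro ⟨k, h1, h2⟩
    rwa [h _ _ h1]
  · obtain rfl := h _ _ h1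
    exact ⟨x, h1, h1⟩

theorem compatible_of_germAct {s t : S}
    (h1 : ∀ x y z, germAct s x y → germAct t x z → y = z)
    (h2 : ∀ x y z, germAct s x z → germAct t y z → x = y) : Compatible s t := by
  constructor
  · apply isIdempotentElem_of_germAct_eq
    intro x y h
    obtain ⟨k, h3, h4⟩ := germAct_mul.1 h
    exact (h2 _ _ _ (germAct_inv.1 h4) h3).symm
  · apply isIdempotentElem_of_germAct_eq
    intro x y h
    obtain ⟨k, h3, h4⟩ := germAct_mul.1 h
    exact (h1 _ _ _ h4 (germAct_inv.1 h3)).symm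

/-! ### The unitization as an inverse semigroup of relations -/

/-- The relation of the formal element `s ∨ (b \ g)`, with `b` either `0` or `1`. -/
def unitRel (b : Prop) (g : Idem S) (s : S) : Germ S → Germ S → Prop :=
  fun x y => germAct s x y ∨ (b ∧ x = y ∧ ¬ germAct g.val x y)

theorem unitRel_false (g : Idem S) (s : S) : unitRel False g s = germAct s := by
  ext x y
  simp [unitRel]

/-- When `b` holds, split the identity off `g` into `h \ g` and the identity off `h`, and absorb `h
\ g` into `s` by a join in `S`. When `b` fails, `s` already serves. -/
theorem exists_unitRel_eq (b : Prop) {g h : Idem S} {s : S} (hs : IsLocal g s) (hgh : g ≤ h) :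
    ∃ r, IsLocal h r ∧ unitRel b g s = unitRel b h r := by
  by_cases hb : b
  swap
  · exact ⟨s, hs.mono hgh, by ext x y; simp [unitRel, hb]⟩
  have hcompat : Compatible s (h \ g).val := by
    apply compatible_of_germAct
    · intro x y z h1 h2
      rw [germAct_sdiff] at h2
      obtain rfl := germAct_idem_eq h.property h2.1
      exact absurd (germAct_of_isLocal hs h1).1 h2.2
    · intro x y z h1 h2
      rw [germAct_sdiff] at h2
      obtain rfl := germAct_idem_eq h.property h2.1
      exact absurd (germAct_of_isLocal hs h1).2 h2.2
  obtain ⟨c, hc⟩ := DistributiveInverseSemigroup.exists_join _ _ hcompat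
  refine ⟨c, (hs.mono hgh).join (isLocal_of_le sdiff_le) hc, ?_⟩
  ext x y
  have h1 : germAct h.val x y → x = y := germAct_idem_eq h.property
  have h2 : germAct g.val x y → germAct h.val x y := germAct_mono ((idem_le_iff _ _).1 hgh)
  simp only [unitRel, germAct_join hc, germAct_sdiff]
  tauto

variable (S) in
/-- The unitization of a Boolean inverse semigroup, as partial bijections of its germs. -/
def BooleanUnitization : Type u :=
  {R : Germ S → Germ S → Prop // ∃ (b : Prop) (g : Idem S) (s : S), IsLocal g s ∧ R = unitRel b g s}

namespace BooleanUnitization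

/-- The element `s ∨ (b \ g)`. -/
def mk (b : Prop) {g : Idem S} {s : S} (hs : IsLocal g s) : BooleanUnitization S :=
  ⟨unitRel b g s, b, g, s, hs, rfl⟩

theorem ext {a b : BooleanUnitization S} (h : ∀ x y, a.val x y ↔ b.val x y) : a = b :=
  Subtype.ext (funext₂ fun x y => propext (h x y))

theorem exists_mk (a : BooleanUnitization S) :
    ∃ (b : Prop) (g : Idem S) (s : S) (hs : IsLocal g s), a = mk b hs := by
  obtain ⟨R, b, g, s, hs, rfl⟩ := a
  exact ⟨b, g, s, hs, rfl⟩

theorem mk_mono (b : Prop) {g h : Idem S} {s : S} (hs : IsLocal g s) (hgh : g ≤ h) :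
    ∃ (r : S) (hr : IsLocal h r), mk b hs = mk b hr := by
  obtain ⟨r, hr, h⟩ := exists_unitRel_eq b hs hgh
  exact ⟨r, hr, Subtype.ext h⟩

/-- Two elements may be written over the same idempotent. -/
theorem exists_mk₂ (a₁ a₂ : BooleanUnitization S) :
    ∃ (g : Idem S) (b₁ b₂ : Prop) (s₁ s₂ : S) (h₁ : IsLocal g s₁) (h₂ : IsLocal g s₂),
      a₁ = mk b₁ h₁ ∧ a₂ = mk b₂ h₂ := by
  obtain ⟨b₁, g₁, s₁, h₁, rfl⟩ := exists_mk a₁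
  obtain ⟨b₂, g₂, s₂, h₂, rfl⟩ := exists_mk a₂
  obtain ⟨r₁, hr₁, e₁⟩ := mk_mono b₁ h₁ (le_sup_left : g₁ ≤ g₁ ⊔ g₂)
  obtain ⟨r₂, hr₂, e₂⟩ := mk_mono b₂ h₂ (le_sup_right : g₂ ≤ g₁ ⊔ g₂)
  exact ⟨_, b₁, b₂, r₁, r₂, hr₁, hr₂, e₁, e₂⟩

theorem right_unique (a : BooleanUnitization S) {x y z : Germ S} (h1 : a.val x y)
    (h2 : a.val x z) : y = z := by
  obtain ⟨b, g, s, hs, rfl⟩ := exists_mk a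
  rcases h1 with h1 | ⟨-, rfl, h1⟩ <;> rcases h2 with h2 | ⟨-, rfl, h2⟩
  · exact germAct_right_unique h1 h2
  · exact absurd (germAct_of_isLocal hs h1).1 h2
  · exact absurd (germAct_of_isLocal hs h2).1 h1
  · rfl

theorem left_unique (a : BooleanUnitization S) {x y z : Germ S} (h1 : a.val x z)
    (h2 : a.val y z) : x = y := by
  obtain ⟨b, g, s, hs, rfl⟩ := exists_mk a
  rcases h1 with h1 | ⟨-, rfl, h1⟩ <;> rcases h2 with h2 | ⟨-, rfl, h2⟩
  · exact germAct_left_unique h1 h2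
  · exact absurd (germAct_of_isLocal hs h1).2 h2
  · exact absurd (germAct_of_isLocal hs h2).2 h1
  · rfl

theorem exists_mul (a₁ a₂ : BooleanUnitization S) : ∃ c : BooleanUnitization S,
    ∀ x y, c.val x y ↔ ∃ z, a₂.val x z ∧ a₁.val z y := by
  obtain ⟨g, b₁, b₂, s₁, s₂, h₁, h₂, rfl, rfl⟩ := exists_mk₂ a₁ a₂
  -- Over a common `g` the mixed composites are empty: one factor acts inside `g`, the other off it.
  refine ⟨mk (b₁ ∧ b₂) (h₁.mul h₂), fun x y => ?_⟩
  simp only [mk, unitRel, germAct_mul]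
  constructor
  · rintro (⟨z, h3, h4⟩ | ⟨⟨h3, h4⟩, rfl, h5⟩)
    · exact ⟨z, Or.inl h3, Or.inl h4⟩
    · exact ⟨x, Or.inr ⟨h4, rfl, h5⟩, Or.inr ⟨h3, rfl, h5⟩⟩
  · rintro ⟨z, h3 | ⟨h3, rfl, h4⟩, h5 | ⟨h5, rfl, h6⟩⟩
    · exact Or.inl ⟨z, h3, h5⟩
    · exact absurd (germAct_of_isLocal h₂ h3).2 h6
    · exact absurd (germAct_of_isLocal h₁ h5).1 h4
    · exact Or.inr ⟨⟨h5, h3⟩, rfl, h4⟩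

theorem exists_inv (a : BooleanUnitization S) : ∃ c : BooleanUnitization S,
    ∀ x y, c.val x y ↔ a.val y x := by
  obtain ⟨b, g, s, hs, rfl⟩ := exists_mk a
  refine ⟨mk b hs.inv, fun x y => ?_⟩
  simp only [mk, unitRel, germAct_inv]
  refine or_congr Iff.rfl (and_congr Iff.rfl ⟨?_, ?_⟩) <;>
  · rintro ⟨rfl, h⟩
    exact ⟨rfl, h⟩

noncomputable instance : Mul (BooleanUnitization S) := ⟨fun a b => (exists_mul a b).choose⟩

noncomputable instance : Inv (BooleanUnitization S) := ⟨fun a => (exists_inv a).choose⟩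

theorem mul_val {a b : BooleanUnitization S} {x y : Germ S} :
    (a * b).val x y ↔ ∃ z, b.val x z ∧ a.val z y := (exists_mul a b).choose_spec x y

theorem inv_val {a : BooleanUnitization S} {x y : Germ S} :
    a⁻¹.val x y ↔ a.val y x := (exists_inv a).choose_spec x y

theorem isLocal_zero (g : Idem S) : IsLocal g (0 : S) := ⟨mul_zero _, zero_mul _⟩

instance : Zero (BooleanUnitization S) := ⟨mk False (isLocal_zero ⊥)⟩

instance : One (BooleanUnitization S) := ⟨mk True (isLocal_zero ⊥)⟩

theorem zero_val {x y : Germ S} : ¬ (0 : BooleanUnitization S).val x y := by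
  change ¬ unitRel False ⊥ 0 x y
  rw [unitRel_false]
  exact not_germAct_zero x y

theorem one_val {x y : Germ S} : (1 : BooleanUnitization S).val x y ↔ x = y := by
  change unitRel True ⊥ 0 x y ↔ x = y
  simp [unitRel, val_bot, not_germAct_zero]

/-- Half of the uniqueness of inverses: `a` contains the converse of `b`. Exchanging the roles gives
equality. -/
theorem val_inv_of_mul_mul {a b : BooleanUnitization S} (h : b * a * b = b) {x y : Germ S}
    (hb : b.val x y) : a.val y x := by
  have h1 := hb
  rw [← h, mul_val] at h1
  obtain ⟨p, h2, h1⟩ := h1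
  obtain ⟨q, h3, h4⟩ := mul_val.1 h1
  rwa [b.right_unique hb h2, b.left_unique hb h4]

noncomputable instance instInverseSemigroup : InverseSemigroup (BooleanUnitization S) where
  mul_assoc a b c := ext fun x y => by
    simp only [mul_val]
    constructor
    · rintro ⟨z, h1, w, h2, h3⟩
      exact ⟨w, ⟨z, h1, h2⟩, h3⟩
    · rintro ⟨w, ⟨z, h1, h2⟩, h3⟩
      exact ⟨z, h1, w, h2, h3⟩
  mul_inv_mul a := ext fun x y => by
    simp only [mul_val, inv_val]
    constructor
    · rintro ⟨z, h1, w, h2, h3⟩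
      rwa [a.left_unique h1 h2]
    · intro h
      exact ⟨y, h, x, h, h⟩
  inv_mul_inv a := ext fun x y => by
    simp only [mul_val, inv_val]
    constructor
    · rintro ⟨z, h1, w, h2, h3⟩
      rwa [a.right_unique h1 h2]
    · intro h
      exact ⟨y, h, x, h, h⟩
  eq_inv_of a b h1 h2 := ext fun x y => by
    rw [inv_val]
    exact ⟨val_inv_of_mul_mul h2, val_inv_of_mul_mul h1⟩

/-! ### Order, joins and idempotents of the unitization -/

theorem isIdempotentElem_iff {a : BooleanUnitization S} :
    IsIdempotentElem a ↔ ∀ x y, a.val x y → x = y := by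
  constructor
  · intro h x y hx
    have h1 := hx
    rw [← h.eq, mul_val] at h1
    obtain ⟨z, h2, h3⟩ := h1
    obtain rfl := a.right_unique hx h2
    exact a.left_unique hx h3
  · intro h
    refine ext fun x y => ?_
    rw [mul_val]
    constructor
    · rintro ⟨z, h1, h2⟩
      rwa [h _ _ h1]
    · intro h1
      obtain rfl := h _ _ h1
      exact ⟨x, h1, h1⟩

theorem le_iff {a b : BooleanUnitization S} : a ≤ b ↔ ∀ x y, a.val x y → b.val x y := by
  constructor
  · rintro ⟨e, he, rfl⟩ x y h
    obtain ⟨z, h1, h2⟩ := mul_val.1 h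
    rwa [isIdempotentElem_iff.1 he _ _ h1]
  · intro h
    refine ⟨a⁻¹ * a, isIdempotentElem_inv_mul a, ext fun x y => ?_⟩
    simp only [mul_val, inv_val]
    constructor
    · intro h1
      exact ⟨x, ⟨y, h1, h1⟩, h _ _ h1⟩
    · rintro ⟨z, ⟨w, h1, h2⟩, h3⟩
      rw [a.left_unique h1 h2]
      rwa [b.right_unique h3 (h _ _ h2)]

theorem isLUB_of_val {a b c : BooleanUnitization S}
    (h : ∀ x y, c.val x y ↔ a.val x y ∨ b.val x y) : IsLUB {a, b} c := by
  constructor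
  · rintro t (rfl | rfl) <;> rw [le_iff] <;> intro x y ht <;> rw [h] <;> tauto
  · intro t ht
    have h1 := le_iff.1 (ht (by simp : a ∈ ({a, b} : Set _)))
    have h2 := le_iff.1 (ht (by simp : b ∈ ({a, b} : Set _)))
    rw [le_iff]
    intro x y hc
    exact ((h x y).1 hc).elim (h1 x y) (h2 x y)

theorem compatible_spec {a b : BooleanUnitization S} (h : Compatible a b) :
    (∀ x y z, a.val x y → b.val x z → y = z) ∧ ∀ x y z, a.val x z → b.val y z → x = y := by
  constructor
  · intro x y z h1 h2
    exact (isIdempotentElem_iff.1 h.2 z y (mul_val.2 ⟨x, inv_val.2 h2, h1⟩)).symm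
  · intro x y z h1 h2
    exact (isIdempotentElem_iff.1 h.1 y x (mul_val.2 ⟨z, h2, inv_val.2 h1⟩)).symm

theorem exists_union {a b : BooleanUnitization S} (h : Compatible a b) :
    ∃ c : BooleanUnitization S, ∀ x y, c.val x y ↔ a.val x y ∨ b.val x y := by
  have h := compatible_spec h
  obtain ⟨g, b₁, b₂, s₁, s₂, h₁, h₂, rfl, rfl⟩ := exists_mk₂ a b
  obtain ⟨c, hc⟩ := DistributiveInverseSemigroup.exists_join s₁ s₂ (compatible_of_germAct
    (fun x y z h3 h4 => h.1 x y z (Or.inl h3) (Or.inl h4))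
    (fun x y z h3 h4 => h.2 x y z (Or.inl h3) (Or.inl h4)))
  refine ⟨mk (b₁ ∨ b₂) (h₁.join h₂ hc), fun x y => ?_⟩
  simp only [mk, unitRel, germAct_join hc]
  tauto

/-- The union of compatible elements is again in the unitization, so it is the only possible join;
distributivity thereby becomes distributivity of composition over union. -/
theorem isLUB_iff {a b c : BooleanUnitization S} (h : Compatible a b) :
    IsLUB {a, b} c ↔ ∀ x y, c.val x y ↔ a.val x y ∨ b.val x y := by
  refine ⟨fun hc => ?_, isLUB_of_val⟩
  obtain ⟨d, hd⟩ := exists_union h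
  rwa [hc.unique (isLUB_of_val hd)]

noncomputable instance instDistributiveInverseSemigroup :
    DistributiveInverseSemigroup (BooleanUnitization S) where
  zero_mul a := ext fun x y => by simp [mul_val, zero_val]
  mul_zero a := ext fun x y => by simp [mul_val, zero_val]
  exists_join a b h := (exists_union h).imp fun _ => isLUB_of_val
  mul_join a b c d h hc := by
    rw [isLUB_iff h] at hc
    refine isLUB_of_val fun x y => ?_
    simp only [mul_val, hc, or_and_right, exists_or]
  join_mul a b c d h hc := by
    rw [isLUB_iff h] at hc
    refine isLUB_of_val fun x y => ?_
    simp only [mul_val, hc, and_or_left, exists_or]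

theorem exists_sdiff (e f : Idem (BooleanUnitization S)) : ∃ c : Idem (BooleanUnitization S),
    ∀ x y, c.val.val x y ↔ e.val.val x y ∧ ¬ f.val.val x y := by
  obtain ⟨e, he⟩ := e
  obtain ⟨f, hf⟩ := f
  rw [isIdempotentElem_iff] at he hf
  obtain ⟨g, b₁, b₂, s₁, s₂, h₁, h₂, rfl, rfl⟩ := exists_mk₂ e f
  have i₁ := isIdempotentElem_of_germAct_eq fun x y h => he x y (Or.inl h)
  have i₂ := isIdempotentElem_of_germAct_eq fun x y h => hf x y (Or.inl h)
  -- Inside `g` the difference is taken in `S`; off `g` it is governed by the flag `b₁ ∧ ¬ b₂`.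
  let t : Idem S := ⟨s₁, i₁⟩ \ ⟨s₂, i₂⟩
  have htg : t ≤ g := sdiff_le.trans (le_iff_mul.2 h₁.1)
  have key : ∀ x y, (mk (b₁ ∧ ¬ b₂) (isLocal_of_le htg)).val x y ↔
      (mk b₁ h₁).val x y ∧ ¬ (mk b₂ h₂).val x y := by
    intro x y
    have h3 : germAct s₁ x y → germAct g.val x y := fun h => by
      have := (germAct_of_isLocal h₁ h).1
      rwa [← germAct_idem_eq i₁ h]
    have h4 : germAct s₂ x y → germAct g.val x y := fun h => by
      have := (germAct_of_isLocal h₂ h).1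
      rwa [← germAct_idem_eq i₂ h]
    have h5 : germAct t.val x y ↔ germAct s₁ x y ∧ ¬ germAct s₂ x y := germAct_sdiff _ _
    simp only [mk, unitRel, h5]
    tauto
  exact ⟨⟨_, isIdempotentElem_iff.2 fun x y h => he x y ((key x y).1 h).1⟩, key⟩

theorem exists_sup (e f : Idem (BooleanUnitization S)) : ∃ c : Idem (BooleanUnitization S),
    ∀ x y, c.val.val x y ↔ e.val.val x y ∨ f.val.val x y := by
  have h : Compatible e.val f.val := by
    rw [Compatible, inv_eq_of_isIdempotentElem e.property, inv_eq_of_isIdempotentElem f.property]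
    exact ⟨isIdempotentElem_mul e.property f.property, isIdempotentElem_mul e.property f.property⟩
  obtain ⟨c, hc⟩ := exists_union h
  exact ⟨⟨c, isIdempotentElem_iff.2 fun x y hxy => ((hc x y).1 hxy).elim
    (isIdempotentElem_iff.1 e.property x y) (isIdempotentElem_iff.1 f.property x y)⟩, hc⟩

theorem inf_val (e f : Idem (BooleanUnitization S)) (x y : Germ S) :
    (e.val * f.val).val x y ↔ e.val.val x y ∧ f.val.val x y := by
  have he := isIdempotentElem_iff.1 e.property
  have hf := isIdempotentElem_iff.1 f.property
  rw [mul_val]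
  constructor
  · rintro ⟨z, h1, h2⟩
    obtain rfl := hf _ _ h1
    obtain rfl := he _ _ h2
    exact ⟨h2, h1⟩
  · rintro ⟨h1, h2⟩
    obtain rfl := hf _ _ h2
    exact ⟨x, h2, h1⟩

/-- The idempotents, as relations, form a generalized Boolean algebra. -/
@[reducible]
noncomputable def idemAlgebra : GeneralizedBooleanAlgebra (Idem (BooleanUnitization S)) :=
  letI : LE (Idem (BooleanUnitization S)) := ⟨fun e f => e.val ≤ f.val⟩
  letI : LT (Idem (BooleanUnitization S)) := ⟨fun e f => e.val < f.val⟩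
  letI : Max (Idem (BooleanUnitization S)) := ⟨fun e f => (exists_sup e f).choose⟩
  letI : Min (Idem (BooleanUnitization S)) :=
    ⟨fun e f => ⟨e.val * f.val, isIdempotentElem_mul e.property f.property⟩⟩
  letI : SDiff (Idem (BooleanUnitization S)) := ⟨fun e f => (exists_sdiff e f).choose⟩
  letI : Bot (Idem (BooleanUnitization S)) := ⟨⟨0, mul_zero 0⟩⟩
  have hle : ∀ {e f : BooleanUnitization S}, e.val ≤ f.val ↔ e ≤ f := fun {e f} => le_iff.symm
  -- The laws are pulled back from the Boolean algebra of all relations on germs.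
  Function.Injective.generalizedBooleanAlgebra
    (fun e : Idem (BooleanUnitization S) => e.val.val)
    (fun _ _ h => Subtype.ext (Subtype.ext h))
    hle
    (fun {e f} => by
      change _ ↔ e.val < f.val
      rw [lt_iff_le_not_ge, lt_iff_le_not_ge, hle, hle])
    (fun e f => funext₂ fun x y => propext ((exists_sup e f).choose_spec x y))
    (fun e f => funext₂ fun x y => propext (inf_val e f x y))
    (funext₂ fun x y => propext (iff_of_false zero_val id))
    (fun e f => funext₂ fun x y => propext ((exists_sdiff e f).choose_spec x y))

noncomputable instance instBooleanInverseMonoid : BooleanInverseMonoid (BooleanUnitization S) where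
  idemAlgebra := idemAlgebra
  idem_le_iff _ _ := Iff.rfl
  one_mul a := ext fun x y => by simp [mul_val, one_val]
  mul_one a := ext fun x y => by simp [mul_val, one_val]

theorem sdiff_val (e f : Idem (BooleanUnitization S)) (x y : Germ S) :
    (e \ f).val.val x y ↔ e.val.val x y ∧ ¬ f.val.val x y :=
  (exists_sdiff e f).choose_spec x y

/-! ### The embedding of `S` and its image -/

/-- The partial bijection of an element of `S`, as an element of the unitization. -/
def ofElem (s : S) : BooleanUnitization S :=
  ⟨germAct s, False, (exists_isLocal s).choose, s, (exists_isLocal s).choose_spec,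
    (unitRel_false _ _).symm⟩

/-- The embedding of `S` into its unitization. -/
noncomputable def of : S →ₙ* BooleanUnitization S where
  toFun := ofElem
  map_mul' s t := ext fun x y =>
    (germAct_mul : germAct (s * t) x y ↔ _).trans
      (mul_val (a := ofElem s) (b := ofElem t)).symm

theorem of_val (s : S) : (of s).val = germAct s := rfl

theorem of_injective : Function.Injective (of : S →ₙ* BooleanUnitization S) :=
  fun _ _ h => germAct_injective (congrArg Subtype.val h)

theorem mk_eq_of {b : Prop} (hb : ¬ b) {g : Idem S} {s : S} (hs : IsLocal g s) :
    mk b hs = of s :=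
  ext fun x y => by simp [mk, unitRel, of_val, hb]

theorem isIdempotentElem_of_of {e : S} (h : IsIdempotentElem (of e)) : IsIdempotentElem e :=
  of_injective (by rw [map_mul]; exact h)

/-- Write `t` over an idempotent large enough that `r` is local to it. The image of `r` then avoids
the identity part of `t`, so only the part of `t` from `S` contributes. -/
theorem exists_of_mul (t : BooleanUnitization S) (r : S) : ∃ s, t * of r = of s := by
  obtain ⟨g, hg⟩ := exists_isLocal r
  obtain ⟨b, h, s, hs, rfl⟩ := exists_mk t
  obtain ⟨s', hs', e⟩ := mk_mono b hs (le_sup_left : h ≤ h ⊔ g)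
  have hr := hg.mono (le_sup_right : g ≤ h ⊔ g)
  rw [e]
  refine ⟨s' * r, ext fun x y => ?_⟩
  rw [mul_val, of_val, of_val, germAct_mul]
  refine exists_congr fun z => and_congr_right fun h1 => or_iff_left ?_
  rintro ⟨-, rfl, h2⟩
  exact h2 (germAct_of_isLocal hr h1).2

theorem of_inv (s : S) : (of s)⁻¹ = of s⁻¹ :=
  ext fun x y => by rw [inv_val, of_val, of_val, germAct_inv]

theorem exists_mul_of (t : BooleanUnitization S) (r : S) : ∃ s, of r * t = of s := by
  obtain ⟨s, hs⟩ := exists_of_mul t⁻¹ r⁻¹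
  refine ⟨s⁻¹, ?_⟩
  rw [← of_inv, ← hs, mul_inv_rev', ← of_inv, inv_inv', inv_inv']

theorem isSemigroupIdeal_range :
    IsSemigroupIdeal (Set.range (of : S →ₙ* BooleanUnitization S)) where
  nonempty := ⟨_, 0, rfl⟩
  mul_mem_left := by
    rintro t _ ⟨r, rfl⟩
    obtain ⟨s, hs⟩ := exists_of_mul t r
    exact ⟨s, hs.symm⟩
  mul_mem_right := by
    rintro t _ ⟨r, rfl⟩
    obtain ⟨s, hs⟩ := exists_mul_of t r
    exact ⟨s, hs.symm⟩

theorem isBISSubalgebra_range :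
    IsBISSubalgebra (Set.range (of : S →ₙ* BooleanUnitization S)) where
  zero_mem := ⟨0, ext fun x y => iff_of_false (not_germAct_zero x y) zero_val⟩
  mul_mem := by
    rintro _ ⟨s, rfl⟩ _ ⟨t, rfl⟩
    exact ⟨s * t, map_mul _ _ _⟩
  inv_mem := by
    rintro _ ⟨s, rfl⟩
    exact ⟨s⁻¹, (of_inv s).symm⟩
  join_mem := by
    rintro _ ⟨s, rfl⟩ _ ⟨t, rfl⟩ h c hc
    have hst := compatible_spec h
    obtain ⟨d, hd⟩ := DistributiveInverseSemigroup.exists_join s t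
      (compatible_of_germAct hst.1 hst.2)
    refine ⟨d, ext fun x y => ?_⟩
    rw [(isLUB_iff h).1 hc, of_val, germAct_join hd]
    rfl
  sdiff_mem := by
    rintro ⟨_, he⟩ ⟨_, hf⟩ ⟨e, rfl⟩ ⟨f, rfl⟩
    let e' : Idem S := ⟨e, isIdempotentElem_of_of he⟩
    let f' : Idem S := ⟨f, isIdempotentElem_of_of hf⟩
    exact ⟨(e' \ f').val, ext fun x y => (germAct_sdiff e' f').trans
      (sdiff_val ⟨of e, he⟩ ⟨of f, hf⟩ x y).symm⟩

theorem exists_isLUB_of_notMem_range (t : BooleanUnitization S)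
    (ht : t ∉ Set.range (of : S →ₙ* BooleanUnitization S)) :
    ∃ (e : Idem S) (s : S), (∃ x : S, s = e.val * x * e.val) ∧
      IsLUB {(e.map of).compl.val, of s} t := by
  obtain ⟨b, g, s, hs, rfl⟩ := exists_mk t
  have hb : b := by
    by_contra hb
    exact ht ⟨s, (mk_eq_of hb hs).symm⟩
  -- With `b` true, the identity part of `t` is exactly the complement of `g`.
  refine ⟨g, s, ⟨s, by rw [hs.1, hs.2]⟩, isLUB_of_val fun x y => ?_⟩
  have h1 : (g.map of).compl.val.val x y ↔ x = y ∧ ¬ germAct g.val x y :=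
    (sdiff_val _ _ x y).trans (and_congr_left' one_val)
  rw [h1, or_comm]
  exact or_congr Iff.rfl (and_iff_right hb)

end BooleanUnitization

end BooleanInverseSemigroup

/-- Unitization. The construction also makes sense when `S` has an identity; `hS` only ensures that
`S` embeds as a proper ideal. -/
theorem mainTheorem6 (S : Type u) [BooleanInverseSemigroup S]
    (hS : ¬ ∃ i : S, ∀ s : S, i * s = s ∧ s * i = s) :
    ∃ (T : Type u) (_ : BooleanInverseMonoid T) (φ : S →ₙ* T),
      Function.Injective φ ∧
      IsBISSubalgebra (Set.range φ) ∧
      IsSemigroupIdeal (Set.range φ) ∧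
      ∀ t : T, t ∉ Set.range φ →
        ∃ (e : Idem S) (s : S), (∃ x : S, s = e.val * x * e.val) ∧
          IsLUB {(e.map φ).compl.val, φ s} t :=
  ⟨BooleanInverseSemigroup.BooleanUnitization S, inferInstance,
    BooleanInverseSemigroup.BooleanUnitization.of,
    BooleanInverseSemigroup.BooleanUnitization.of_injective,
    BooleanInverseSemigroup.BooleanUnitization.isBISSubalgebra_range,
    BooleanInverseSemigroup.BooleanUnitization.isSemigroupIdeal_range,
    BooleanInverseSemigroup.BooleanUnitization.exists_isLUB_of_notMem_range⟩
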